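/- Let $E=\{(p,q)\in\mathbb{R}^2 : p\le 0 \text{ or } 0<p\le 3q\}$. For $t\in(0,1)$ and $(p,q)\in E$ let $$M(t;p,q)=\begin{cases}\left(1-\frac{p}{3q}+\frac{p}{3q}t^{q}\right)^{1/p} & \text{if } p\neq 0,\ q\neq 0,\\ \exp\frac{t^{q}-1}{3q} & \text{if } p=0,\ q\neq 0,\\ \left(\frac{p}{3}\ln t+1\right)^{1/p} & \text{if } p<0,\ q=0,\\ t^{1/3} & \text{if } p=q=0,\end{cases}$$ (the last three lines being the limits of the first), and let $$q(p)=\frac{p}{3\left(1-(2/\pi)^{p}\right)}\ \text{ if } p\neq 0,\qquad q(0)=-\frac{1}{3\ln(2/\pi)}.$$ The equations $q(p)=1$ and $q(p)=34/35$ have unique real solutions $p_0$ and $p_0^{\ast}$ respectively; numerically $|p_0-1.42034|<10^{-5}$ and $|p_0^{\ast}-1.27754|<10^{-5}$. For every $(p,q)\in E$ the following hold. (i) If $p\ge 7/5$, then $\frac{\sin x}{x}<M(\cos x;p,q)$ holds for all $x\in(0,\pi/2)$ if and only if $q\ge \frac p3+\frac{8}{15}$. (ii) If $p\ge p_0$,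 then $\frac{\sin x}{x}>M(\cos x;p,q)$ holds for all $x\in(0,\pi/2)$ if and only if $q\le q(p)$. (iii) If $p\le 46/35$, then $\frac{\sin x}{x}>M(\cos x;p,q)$ holds for all $x\in(0,\pi/2)$ if and only if $q\le \frac p3+\frac{8}{15}$. (iv) If $p\le p_0^{\ast}$, then $\frac{\sin x}{x}<M(\cos x;p,q)$ holds for all $x\in(0,\pi/2)$ if and only if $q\ge q(p)$. -/

import Mathlib

open Set

noncomputable section

/-- The admissible parameter region `{(p, q) : p ≤ 0 or 0 < p ≤ 3 q}`. -/
def admissibleRegion : Set (ℝ × ℝ) :=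
  {z | z.1 ≤ 0 ∨ (0 < z.1 ∧ z.1 ≤ 3 * z.2)}

/-- The bound `(1 - p/(3q) + p/(3q) t^q)^(1/p)`, extended by its limits to `p = 0` and to
`q = 0` (with `p ≤ 0`, since `p > 0`, `q = 0` is not admissible). For `t ∈ (0, 1)` and admissible
`(p, q)` every base of a real power below is positive. -/
def cusaBound (t p q : ℝ) : ℝ :=
  if p = 0 then
    if q = 0 then t ^ (1 / 3 : ℝ)
    else Real.exp ((t ^ q - 1) / (3 * q))
  else
    if q = 0 then (p / 3 * Real.log t + 1) ^ (1 / p)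
    else (1 - p / (3 * q) + p / (3 * q) * t ^ q) ^ (1 / p)

/-- The critical exponent `q(p) = p / (3 (1 - (2/π)^p))`, with its limit value at `p = 0`. -/
def critExponent (p : ℝ) : ℝ :=
  if p = 0 then -1 / (3 * Real.log (2 / Real.pi))
  else p / (3 * (1 - (2 / Real.pi) ^ p))

end

/-! The map `boxCox p`, `y ↦ (y^p - 1)/p` (with `log` at `p = 0`), is increasing on the positive
reals and carries the bound `M(t;p,q)` to `boxCox q t / 3`. All four cases of the definition thus
merge, and each inequality becomes a sign condition on `cusaGap p q x = boxCox p (sin x / x) -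
boxCox q (cos x) / 3`, which decreases in `q`. Only the boundary values of `q` need a sufficiency
proof.

The gap tends to 0 at `0+` and its derivative is a positive factor times `1 - exp (logSlope p q x)`.
The derivative of `logSlope` is a positive factor times `slopeSign p q = (q - 1) tanRatio - (p - 1)
+ defectRatio`, and `logSlope` also starts from 0. Both ratios increase, and `defectRatio' <
tanRatio' / 35`, so `slopeSign` increases for `q ≥ 1` and decreases for `q ≤ 34/35`. Its limit at
`0+` is `3q - p - 8/5`.

If `q = p/3 + 8/15` this limit is 0, so `slopeSign` has one sign and hence so does the gap. If `q =
q(p)` the gap vanishes at both ends, and the single possible sign change of `slopeSign` prevents it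
from changing sign inside. Necessity is read off from the behaviour at `0+` and at `π/2`. The
trigonometric inequalities behind the monotonicity reduce to polynomial ones by alternating Taylor
bounds. -/

open Filter Topology

/-! ### Alternating Taylor bounds for sine and cosine. -/

/-- Partial sums of the Taylor series of the cosine. -/
noncomputable def cosTaylor (n : ℕ) (x : ℝ) : ℝ :=
  ∑ k ∈ Finset.range n, (-1) ^ k * x ^ (2 * k) / (2 * k).factorial

/-- Partial sums of the Taylor series of the sine. -/
noncomputable def sinTaylor (n : ℕ) (x : ℝ) : ℝ :=
  ∑ k ∈ Finset.range n, (-1) ^ k * x ^ (2 * k + 1) / (2 * k + 1).factorial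

theorem hasDerivAt_sinTaylor (n : ℕ) (x : ℝ) :
    HasDerivAt (sinTaylor n) (cosTaylor n x) x := by
  unfold sinTaylor cosTaylor
  refine HasDerivAt.fun_sum fun k _ => ?_
  have h := ((hasDerivAt_pow (2 * k + 1) x).const_mul ((-1 : ℝ) ^ k)).div_const
    ((2 * k + 1).factorial : ℝ)
  refine h.congr_deriv ?_
  rw [Nat.factorial_succ]
  have : ((2 * k).factorial : ℝ) ≠ 0 := by positivity
  push_cast
  field_simp

theorem hasDerivAt_cosTaylor (n : ℕ) (x : ℝ) :
    HasDerivAt (cosTaylor (n + 1)) (-sinTaylor n x) x := by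
  have hfun : cosTaylor (n + 1) = fun x => (∑ k ∈ Finset.range n,
      (-1) ^ (k + 1) * x ^ (2 * k + 2) / ((2 * k + 2).factorial : ℝ)) + 1 := by
    ext y
    unfold cosTaylor
    rw [Finset.sum_range_succ']
    simp [mul_add]
  rw [hfun]
  unfold sinTaylor
  rw [← Finset.sum_neg_distrib]
  refine HasDerivAt.add_const _ (HasDerivAt.fun_sum fun k _ => ?_)
  have h := ((hasDerivAt_pow (2 * k + 2) x).const_mul ((-1 : ℝ) ^ (k + 1))).div_const
    ((2 * k + 2).factorial : ℝ)
  refine h.congr_deriv ?_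
  rw [Nat.factorial_succ (2 * k + 1)]
  have : ((2 * k + 1).factorial : ℝ) ≠ 0 := by positivity
  push_cast
  rw [pow_succ (-1 : ℝ) k]
  field_simp
  ring

/-- The Taylor polynomials of cosine and sine alternately over- and underestimate them. -/
theorem taylor_alternating (n : ℕ) :
    (∀ x : ℝ, 0 ≤ x → 0 ≤ (-1) ^ (n + 1) * (Real.cos x - cosTaylor (n + 1) x)) ∧
    (∀ x : ℝ, 0 ≤ x → 0 ≤ (-1) ^ (n + 1) * (Real.sin x - sinTaylor (n + 1) x)) := by
  have mono : ∀ f f' : ℝ → ℝ, (∀ x, HasDerivAt f (f' x) x) → (∀ x, 0 ≤ x → 0 ≤ f' x) →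
      f 0 = 0 → ∀ x, 0 ≤ x → 0 ≤ f x := by
    intro f f' hf hf' h0 x hx
    have hm : MonotoneOn f (Ici 0) := by
      refine monotoneOn_of_deriv_nonneg (convex_Ici 0)
        (fun y _ => (hf y).continuousAt.continuousWithinAt)
        (fun y _ => (hf y).differentiableAt.differentiableWithinAt) fun y hy => ?_
      rw [(hf y).deriv]
      rw [interior_Ici] at hy
      exact hf' y (le_of_lt hy)
    have := hm (mem_Ici.2 le_rfl) (mem_Ici.2 hx) hx
    linarith
  have hs0 : ∀ m, sinTaylor m 0 = 0 := fun m => by simp [sinTaylor]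
  have hc0 : ∀ m, cosTaylor (m + 1) 0 = 1 := fun m => by
    simp [cosTaylor, Finset.sum_range_succ']
  -- Integration from 0 gives each bound from the previous one: cosine to sine keeps the sign, sine
  -- to the next cosine flips it.
  have sin_of_cos : ∀ m, (∀ x : ℝ, 0 ≤ x → 0 ≤ (-1) ^ m * (Real.cos x - cosTaylor m x)) →
      (∀ x : ℝ, 0 ≤ x → 0 ≤ (-1) ^ m * (Real.sin x - sinTaylor m x)) := fun m hm =>
    mono _ _ (fun x => ((Real.hasDerivAt_sin x).sub (hasDerivAt_sinTaylor m x)).const_mul _) hm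
      (by simp [hs0])
  induction n with
  | zero =>
    have hc : ∀ x : ℝ, 0 ≤ x → 0 ≤ (-1) ^ (0 + 1) * (Real.cos x - cosTaylor (0 + 1) x) := by
      intro x _
      have := Real.cos_le_one x
      simp [cosTaylor, this]
    exact ⟨hc, sin_of_cos _ hc⟩
  | succ n ih =>
    have hc : ∀ x : ℝ, 0 ≤ x → 0 ≤ (-1) ^ (n + 1 + 1) * (Real.cos x - cosTaylor (n + 1 + 1) x) := by
      refine mono _ (fun x => (-1) ^ (n + 1 + 1) * (-Real.sin x - -sinTaylor (n + 1) x))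
        (fun x => ((Real.hasDerivAt_cos x).sub (hasDerivAt_cosTaylor (n + 1) x)).const_mul _)
        (fun x hx => ?_) (by simp [hc0])
      have := ih.2 x hx
      rw [pow_succ]
      linarith
    exact ⟨hc, sin_of_cos _ hc⟩

theorem cosTaylor_le_cos {n : ℕ} (hn : Even (n + 1)) {x : ℝ} (hx : 0 ≤ x) :
    cosTaylor (n + 1) x ≤ Real.cos x := by
  have := (taylor_alternating n).1 x hx
  rw [hn.neg_one_pow] at this
  linarith

theorem cos_le_cosTaylor {n : ℕ} (hn : Odd (n + 1)) {x : ℝ} (hx : 0 ≤ x) :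
    Real.cos x ≤ cosTaylor (n + 1) x := by
  have := (taylor_alternating n).1 x hx
  rw [hn.neg_one_pow] at this
  linarith

theorem sinTaylor_le_sin {n : ℕ} (hn : Even (n + 1)) {x : ℝ} (hx : 0 ≤ x) :
    sinTaylor (n + 1) x ≤ Real.sin x := by
  have := (taylor_alternating n).2 x hx
  rw [hn.neg_one_pow] at this
  linarith

theorem sin_le_sinTaylor {n : ℕ} (hn : Odd (n + 1)) {x : ℝ} (hx : 0 ≤ x) :
    Real.sin x ≤ sinTaylor (n + 1) x := by
  have := (taylor_alternating n).2 x hx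
  rw [hn.neg_one_pow] at this
  linarith

/-! ### Trigonometric inequalities on `(0, π/2)`. -/

theorem sin_five_mul_expand (x : ℝ) :
    Real.sin (5 * x) = 16 * Real.sin x ^ 5 - 20 * Real.sin x ^ 3 + 5 * Real.sin x := by
  have h : 5 * x = 3 * x + 2 * x := by ring
  rw [h, Real.sin_add, Real.sin_three_mul, Real.cos_three_mul, Real.sin_two_mul, Real.cos_two_mul]
  linear_combination
    (8 * Real.sin x * Real.cos x ^ 2 - 16 * Real.sin x ^ 3 + 8 * Real.sin x) *
      Real.sin_sq_add_cos_sq x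

theorem cos_five_mul_expand (x : ℝ) :
    Real.cos (5 * x) = 16 * Real.cos x ^ 5 - 20 * Real.cos x ^ 3 + 5 * Real.cos x := by
  have h := sin_five_mul_expand (Real.pi / 2 - x)
  rw [Real.sin_pi_div_two_sub] at h
  rw [← h, show 5 * (Real.pi / 2 - x) = Real.pi / 2 - 5 * x + 2 * Real.pi by ring,
    Real.sin_add_two_pi, Real.sin_pi_div_two_sub]

theorem sq_lt_of_lt_pi_div_two {x : ℝ} (hx : 0 < x) (hx2 : x < Real.pi / 2) :
    x ^ 2 < 2.4675 := by
  have := Real.pi_lt_d4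
  nlinarith

/-- This is the numerator of `defectRatio'`. Rewritten linearly in sines and cosines of multiples of
`x`, it can be bounded termwise, the sign of each coefficient fixing the parity of the Taylor
polynomial. -/
theorem ratio_deriv_numerator_pos {x : ℝ} (hx : 0 < x) (hx2 : x < Real.pi / 2) :
    0 < 5 * x * Real.sin x + x * Real.sin x * Real.cos x ^ 2 - 3 * x ^ 2 * Real.cos x -
      2 * x ^ 3 * Real.sin x - 3 * Real.cos x * Real.sin x ^ 2 := by
  have hid : 5 * x * Real.sin x + x * Real.sin x * Real.cos x ^ 2 - 3 * x ^ 2 * Real.cos x -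
    2 * x ^ 3 * Real.sin x - 3 * Real.cos x * Real.sin x ^ 2 =
      21 / 4 * x * Real.sin x + 1 / 4 * x * Real.sin (3 * x) - 3 * x ^ 2 * Real.cos x -
        2 * x ^ 3 * Real.sin x + 3 / 4 * Real.cos (3 * x) - 3 / 4 * Real.cos x := by
    rw [Real.cos_three_mul, Real.sin_three_mul]
    have h2 : Real.sin x ^ 2 = 1 - Real.cos x ^ 2 := Real.sin_sq x
    have h3 : Real.sin x ^ 3 = Real.sin x * (1 - Real.cos x ^ 2) := by rw [pow_succ, h2]; ring
    ring_nf
    simp only [h2, h3]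
    ring
  have hsq := sq_lt_of_lt_pi_div_two hx hx2
  have hx0 := hx
  replace hx := hx.le
  have h3 : 0 ≤ 3 * x := by positivity
  have e0 : 0 ≤ x * (Real.sin x - sinTaylor 6 x) :=
    mul_nonneg (by positivity) (sub_nonneg.2 (sinTaylor_le_sin (n := 5) (by decide) hx))
  have e1 : 0 ≤ x * (Real.sin (3 * x) - sinTaylor 6 (3 * x)) :=
    mul_nonneg (by positivity) (sub_nonneg.2 (sinTaylor_le_sin (n := 5) (by decide) h3))
  have e2 : 0 ≤ x ^ 2 * (cosTaylor 7 x - Real.cos x) :=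
    mul_nonneg (by positivity) (sub_nonneg.2 (cos_le_cosTaylor (n := 6) (by decide) hx))
  have e3 : 0 ≤ x ^ 3 * (sinTaylor 5 x - Real.sin x) :=
    mul_nonneg (by positivity) (sub_nonneg.2 (sin_le_sinTaylor (n := 4) (by decide) hx))
  have e4 : 0 ≤ Real.cos (3 * x) - cosTaylor 8 (3 * x) :=
    sub_nonneg.2 (cosTaylor_le_cos (n := 7) (by decide) h3)
  have e5 : 0 ≤ cosTaylor 7 x - Real.cos x :=
    sub_nonneg.2 (cos_le_cosTaylor (n := 6) (by decide) hx)
  -- What the Taylor polynomials leave: all orders below `x ^ 10` cancel.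
  have hp : 0 < x ^ 10 * (8 / 4725 - 4 / 14175 * x ^ 2 - 4783697 / 116237721600 * x ^ 4) := by
    refine mul_pos (by positivity) ?_
    nlinarith [sq_nonneg x]
  simp only [cosTaylor, sinTaylor, Finset.sum_range_succ, Finset.sum_range_zero, Nat.factorial]
    at e0 e1 e2 e3 e4 e5
  rw [hid]
  push_cast at e0 e1 e2 e3 e4 e5
  linarith [e0, e1, e2, e3, e4, e5, hp]

/-- Division by `x² cos x` turns this into Wilker's inequality `(sin x / x)² + tan x / x > 2`. It
gives the sign of `tanRatio'`. -/
theorem wilker_type {x : ℝ} (hx : 0 < x) (hx2 : x < Real.pi / 2) :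
    0 < Real.sin x ^ 2 * Real.cos x + x * Real.sin x - 2 * x ^ 2 * Real.cos x := by
  have hid : Real.sin x ^ 2 * Real.cos x + x * Real.sin x - 2 * x ^ 2 * Real.cos x =
      -1 / 4 * Real.cos (3 * x) + 1 / 4 * Real.cos x + x * Real.sin x - 2 * x ^ 2 * Real.cos x := by
    rw [Real.cos_three_mul]
    have h2 : Real.sin x ^ 2 = 1 - Real.cos x ^ 2 := Real.sin_sq x
    ring_nf
    simp only [h2]
    ring
  have hsq := sq_lt_of_lt_pi_div_two hx hx2
  have hx0 := hx
  replace hx := hx.le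
  have h3 : 0 ≤ 3 * x := by positivity
  have e0 : 0 ≤ cosTaylor 5 (3 * x) - Real.cos (3 * x) :=
    sub_nonneg.2 (cos_le_cosTaylor (n := 4) (by decide) h3)
  have e1 : 0 ≤ Real.cos x - cosTaylor 6 x :=
    sub_nonneg.2 (cosTaylor_le_cos (n := 5) (by decide) hx)
  have e2 : 0 ≤ x * (Real.sin x - sinTaylor 4 x) :=
    mul_nonneg (by positivity) (sub_nonneg.2 (sinTaylor_le_sin (n := 3) (by decide) hx))
  have e3 : 0 ≤ x ^ 2 * (cosTaylor 5 x - Real.cos x) :=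
    mul_nonneg (by positivity) (sub_nonneg.2 (cos_le_cosTaylor (n := 4) (by decide) hx))
  have hp : 0 < x ^ 6 * (8 / 45 - 4 / 105 * x ^ 2 - 103 / 2073600 * x ^ 4) := by
    refine mul_pos (by positivity) ?_
    nlinarith [sq_nonneg x]
  simp only [cosTaylor, sinTaylor, Finset.sum_range_succ, Finset.sum_range_zero, Nat.factorial]
    at e0 e1 e2 e3
  rw [hid]
  push_cast at e0 e1 e2 e3
  linarith [e0, e1, e2, e3, hp]

/-- Equivalent to `defectRatio' < tanRatio' / 35`. The constant is sharp: the quotient of the two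
derivatives tends to `1/35` at 0, so the `x ^ 10` terms cancel as well and longer expansions are
needed. -/
theorem difference_deriv_numerator_pos {x : ℝ} (hx : 0 < x) (hx2 : x < Real.pi / 2) :
    0 < Real.sin x * (Real.sin x - x * Real.cos x) * (Real.sin x ^ 2 * Real.cos x +
      x * Real.sin x - 2 * x ^ 2 * Real.cos x) -
      35 * Real.cos x ^ 2 * (5 * x * Real.sin x + x * Real.sin x * Real.cos x ^ 2 -
        3 * x ^ 2 * Real.cos x - 2 * x ^ 3 * Real.sin x - 3 * Real.cos x * Real.sin x ^ 2) := by
  have hid : Real.sin x * (Real.sin x - x * Real.cos x) * (Real.sin x ^ 2 * Real.cos x +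
    x * Real.sin x - 2 * x ^ 2 * Real.cos x) -
      35 * Real.cos x ^ 2 * (5 * x * Real.sin x + x * Real.sin x * Real.cos x ^ 2 -
        3 * x ^ 2 * Real.cos x - 2 * x ^ 3 * Real.sin x - 3 * Real.cos x * Real.sin x ^ 2) =
      -13 / 2 * Real.cos (5 * x) - 27 / 4 * Real.cos (3 * x) + 53 / 4 * Real.cos x -
        405 / 8 * x * Real.sin (3 * x) - 95 / 2 * x * Real.sin x +
        27 * x ^ 2 * Real.cos (3 * x) + 78 * x ^ 2 * Real.cos x -
        17 / 8 * x * Real.sin (5 * x) + 18 * x ^ 3 * Real.sin (3 * x) +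
        18 * x ^ 3 * Real.sin x := by
    rw [cos_five_mul_expand, sin_five_mul_expand, Real.cos_three_mul, Real.sin_three_mul]
    have h2 : Real.sin x ^ 2 = 1 - Real.cos x ^ 2 := Real.sin_sq x
    have h3 : Real.sin x ^ 3 = Real.sin x * (1 - Real.cos x ^ 2) := by rw [pow_succ, h2]; ring
    have h4 : Real.sin x ^ 4 = (1 - Real.cos x ^ 2) ^ 2 := by rw [← h2]; ring
    have h5 : Real.sin x ^ 5 = Real.sin x * (1 - Real.cos x ^ 2) ^ 2 := by rw [← h2]; ring
    ring_nf
    simp only [h2, h3, h4, h5]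
    ring
  have hsq := sq_lt_of_lt_pi_div_two hx hx2
  have hx0 := hx
  replace hx := hx.le
  have h3 : 0 ≤ 3 * x := by positivity
  have h5 : 0 ≤ 5 * x := by positivity
  have e0 : 0 ≤ cosTaylor 11 (5 * x) - Real.cos (5 * x) :=
    sub_nonneg.2 (cos_le_cosTaylor (n := 10) (by decide) h5)
  have e1 : 0 ≤ cosTaylor 11 (3 * x) - Real.cos (3 * x) :=
    sub_nonneg.2 (cos_le_cosTaylor (n := 10) (by decide) h3)
  have e2 : 0 ≤ Real.cos x - cosTaylor 12 x :=
    sub_nonneg.2 (cosTaylor_le_cos (n := 11) (by decide) hx)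
  have e3 : 0 ≤ x * (sinTaylor 11 (3 * x) - Real.sin (3 * x)) :=
    mul_nonneg (by positivity) (sub_nonneg.2 (sin_le_sinTaylor (n := 10) (by decide) h3))
  have e4 : 0 ≤ x * (sinTaylor 11 x - Real.sin x) :=
    mul_nonneg (by positivity) (sub_nonneg.2 (sin_le_sinTaylor (n := 10) (by decide) hx))
  have e5 : 0 ≤ x ^ 2 * (Real.cos (3 * x) - cosTaylor 10 (3 * x)) :=
    mul_nonneg (by positivity) (sub_nonneg.2 (cosTaylor_le_cos (n := 9) (by decide) h3))
  have e6 : 0 ≤ x ^ 2 * (Real.cos x - cosTaylor 10 x) :=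
    mul_nonneg (by positivity) (sub_nonneg.2 (cosTaylor_le_cos (n := 9) (by decide) hx))
  have e7 : 0 ≤ x * (sinTaylor 11 (5 * x) - Real.sin (5 * x)) :=
    mul_nonneg (by positivity) (sub_nonneg.2 (sin_le_sinTaylor (n := 10) (by decide) h5))
  have e8 : 0 ≤ x ^ 3 * (Real.sin (3 * x) - sinTaylor 10 (3 * x)) :=
    mul_nonneg (by positivity) (sub_nonneg.2 (sinTaylor_le_sin (n := 9) (by decide) h3))
  have e9 : 0 ≤ x ^ 3 * (Real.sin x - sinTaylor 10 x) :=
    mul_nonneg (by positivity) (sub_nonneg.2 (sinTaylor_le_sin (n := 9) (by decide) hx))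
  have hp : 0 < x ^ 12 * (64 / 1575 - 416 / 17325 * x ^ 2 + 46168 / 7882875 * x ^ 4 -
    179876 / 212837625 * x ^ 6 + 3031129 / 36182396250 * x ^ 8 -
    89988378766939013 / 4496002911110430720000 * x ^ 10) := by
    refine mul_pos (by positivity) ?_
    -- The quintic in `x²` is estimated with powers of the distance from `x²` to the upper end of
    -- its range.
    have hz : 0 ≤ 2.4675 - x ^ 2 := by linarith
    nlinarith [pow_nonneg hz 2, pow_nonneg hz 3, pow_nonneg hz 4, pow_nonneg hz 5]
  simp only [cosTaylor, sinTaylor, Finset.sum_range_succ, Finset.sum_range_zero, Nat.factorial]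
    at e0 e1 e2 e3 e4 e5 e6 e7 e8 e9
  rw [hid]
  push_cast at e0 e1 e2 e3 e4 e5 e6 e7 e8 e9
  linarith [e0, e1, e2, e3, e4, e5, e6, e7, e8, e9, hp]

/-! ### The two ratios and the monotonicity of `slopeSign`. -/

/-- `sin x - x cos x`. -/
noncomputable def sinDefect (x : ℝ) : ℝ := Real.sin x - x * Real.cos x

/-- The quotient of `tan x` by `1 / x - cot x`. -/
noncomputable def tanRatio (x : ℝ) : ℝ := x * Real.sin x ^ 2 / (Real.cos x * sinDefect x)

/-- The quotient of `x sin x / (sin x - x cos x) - 2 / x - cot x` by `1 / x - cot x`. -/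
noncomputable def defectRatio (x : ℝ) : ℝ :=
  x ^ 2 * Real.sin x ^ 2 / sinDefect x ^ 2 - 3 * Real.sin x / sinDefect x + 1

theorem sin_pos_of_mem_quarter {x : ℝ} (hx : x ∈ Ioo 0 (Real.pi / 2)) : 0 < Real.sin x :=
  Real.sin_pos_of_pos_of_lt_pi hx.1 (by linarith [hx.2, Real.pi_pos])

theorem cos_pos_of_mem_quarter {x : ℝ} (hx : x ∈ Ioo 0 (Real.pi / 2)) : 0 < Real.cos x :=
  Real.cos_pos_of_mem_Ioo ⟨by linarith [hx.1, Real.pi_pos], hx.2⟩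

theorem sinDefect_pos {x : ℝ} (hx : x ∈ Ioo 0 (Real.pi / 2)) : 0 < sinDefect x := by
  have hc := cos_pos_of_mem_quarter hx
  have := Real.lt_tan hx.1 hx.2
  rw [Real.tan_eq_sin_div_cos, lt_div_iff₀ hc] at this
  unfold sinDefect
  linarith

theorem hasDerivAt_sinDefect (x : ℝ) : HasDerivAt sinDefect (x * Real.sin x) x := by
  have h := (Real.hasDerivAt_sin x).sub ((hasDerivAt_id x).mul (Real.hasDerivAt_cos x))
  refine h.congr_deriv ?_
  simp

theorem hasDerivAt_tanRatio {x : ℝ} (hx : x ∈ Ioo 0 (Real.pi / 2)) :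
    HasDerivAt tanRatio (Real.sin x *
      (Real.sin x ^ 2 * Real.cos x + x * Real.sin x - 2 * x ^ 2 * Real.cos x) /
        (Real.cos x ^ 2 * sinDefect x ^ 2)) x := by
  have hc := (cos_pos_of_mem_quarter hx).ne'
  have hd := (sinDefect_pos hx).ne'
  have h := ((hasDerivAt_id x).mul ((Real.hasDerivAt_sin x).pow 2)).div
    ((Real.hasDerivAt_cos x).mul (hasDerivAt_sinDefect x)) (mul_ne_zero hc hd)
  refine h.congr_deriv ?_
  simp only [Pi.mul_apply, Pi.pow_apply, id]
  rw [div_eq_div_iff (by positivity) (by positivity)]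
  unfold sinDefect
  have h2 : Real.sin x ^ 2 = 1 - Real.cos x ^ 2 := Real.sin_sq x
  have h4 : Real.sin x ^ 4 = (1 - Real.cos x ^ 2) ^ 2 := by rw [← h2]; ring
  have h3 : Real.sin x ^ 3 = Real.sin x * (1 - Real.cos x ^ 2) := by rw [pow_succ, h2]; ring
  have h5 : Real.sin x ^ 5 = Real.sin x * (1 - Real.cos x ^ 2) ^ 2 := by rw [← h2]; ring
  have h6 : Real.sin x ^ 6 = (1 - Real.cos x ^ 2) ^ 3 := by rw [← h2]; ring
  push_cast
  ring_nf
  simp only [h2, h3, h4, h5, h6]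
  ring

theorem hasDerivAt_defectRatio {x : ℝ} (hx : x ∈ Ioo 0 (Real.pi / 2)) :
    HasDerivAt defectRatio ((5 * x * Real.sin x + x * Real.sin x * Real.cos x ^ 2 -
      3 * x ^ 2 * Real.cos x - 2 * x ^ 3 * Real.sin x - 3 * Real.cos x * Real.sin x ^ 2) /
        sinDefect x ^ 3) x := by
  have hd := (sinDefect_pos hx).ne'
  have h := (((((hasDerivAt_id x).pow 2).mul ((Real.hasDerivAt_sin x).pow 2)).div
    ((hasDerivAt_sinDefect x).pow 2) (pow_ne_zero 2 hd)).sub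
    (((Real.hasDerivAt_sin x).const_mul 3).div (hasDerivAt_sinDefect x) hd)).add_const 1
  refine h.congr_deriv ?_
  simp only [Pi.mul_apply, Pi.pow_apply, id]
  have h2 : Real.sin x ^ 2 = 1 - Real.cos x ^ 2 := Real.sin_sq x
  have h3 : Real.sin x ^ 3 = Real.sin x * (1 - Real.cos x ^ 2) := by rw [pow_succ, h2]; ring
  -- Expressed through `sinDefect`, the numerator matches what the quotient rule produces.
  have hnum : 5 * x * Real.sin x + x * Real.sin x * Real.cos x ^ 2 -
      3 * x ^ 2 * Real.cos x - 2 * x ^ 3 * Real.sin x - 3 * Real.cos x * Real.sin x ^ 2 =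
      (5 * x * Real.sin x ^ 2 + 2 * x ^ 2 * Real.sin x * Real.cos x) * sinDefect x -
        2 * x ^ 3 * Real.sin x ^ 3 - 3 * Real.cos x * sinDefect x ^ 2 := by
    unfold sinDefect
    ring_nf
    simp only [h2, h3]
    ring
  rw [hnum]
  field_simp
  ring

/-- The derivative of `log` of the quotient of derivatives of the two power means, divided by
`1 / x - cot x`. -/
noncomputable def slopeSign (p q x : ℝ) : ℝ := (q - 1) * tanRatio x - (p - 1) + defectRatio x

theorem hasDerivAt_slopeSign (p q : ℝ) {x : ℝ} (hx : x ∈ Ioo 0 (Real.pi / 2)) :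
    HasDerivAt (slopeSign p q) ((q - 1) * (Real.sin x *
      (Real.sin x ^ 2 * Real.cos x + x * Real.sin x - 2 * x ^ 2 * Real.cos x) /
        (Real.cos x ^ 2 * sinDefect x ^ 2)) + (5 * x * Real.sin x +
          x * Real.sin x * Real.cos x ^ 2 -
      3 * x ^ 2 * Real.cos x - 2 * x ^ 3 * Real.sin x - 3 * Real.cos x * Real.sin x ^ 2) /
        sinDefect x ^ 3) x :=
  (((hasDerivAt_tanRatio hx).const_mul (q - 1)).sub_const (p - 1)).add (hasDerivAt_defectRatio hx)

theorem strictMonoOn_slopeSign (p : ℝ) {q : ℝ} (hq : 1 ≤ q) :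
    StrictMonoOn (slopeSign p q) (Ioo 0 (Real.pi / 2)) := by
  refine strictMonoOn_of_deriv_pos (convex_Ioo _ _)
    (fun x hx => (hasDerivAt_slopeSign p q hx).continuousAt.continuousWithinAt) fun x hx => ?_
  rw [interior_Ioo] at hx
  rw [(hasDerivAt_slopeSign p q hx).deriv]
  have hs := sin_pos_of_mem_quarter hx
  have hc := cos_pos_of_mem_quarter hx
  have hd := sinDefect_pos hx
  have h1 := div_pos (ratio_deriv_numerator_pos hx.1 hx.2) (pow_pos hd 3)
  have h2 := div_pos (mul_pos hs (wilker_type hx.1 hx.2)) (mul_pos (pow_pos hc 2) (pow_pos hd 2))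
  have := mul_nonneg (sub_nonneg.2 hq) h2.le
  linarith

/-- Here `q - 1 ≤ -1/35`, so the decrease of `(q - 1) tanRatio` outweighs the increase of
`defectRatio`. -/
theorem strictAntiOn_slopeSign (p : ℝ) {q : ℝ} (hq : q ≤ 34 / 35) :
    StrictAntiOn (slopeSign p q) (Ioo 0 (Real.pi / 2)) := by
  refine strictAntiOn_of_deriv_neg (convex_Ioo _ _)
    (fun x hx => (hasDerivAt_slopeSign p q hx).continuousAt.continuousWithinAt) fun x hx => ?_
  rw [interior_Ioo] at hx
  rw [(hasDerivAt_slopeSign p q hx).deriv]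
  have hs := sin_pos_of_mem_quarter hx
  have hc := cos_pos_of_mem_quarter hx
  have hd := sinDefect_pos hx
  have h2 := div_pos (mul_pos hs (wilker_type hx.1 hx.2)) (mul_pos (pow_pos hc 2) (pow_pos hd 2))
  have h3 := difference_deriv_numerator_pos hx.1 hx.2
  have h4 := mul_nonneg (sub_nonneg.2 hq) h2.le
  set W := Real.sin x ^ 2 * Real.cos x + x * Real.sin x - 2 * x ^ 2 * Real.cos x
  set N := 5 * x * Real.sin x + x * Real.sin x * Real.cos x ^ 2 -
      3 * x ^ 2 * Real.cos x - 2 * x ^ 3 * Real.sin x - 3 * Real.cos x * Real.sin x ^ 2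
  have h5 : 0 < 1 / 35 * (Real.sin x * W / (Real.cos x ^ 2 * sinDefect x ^ 2)) -
      N / sinDefect x ^ 3 := by
    have : 1 / 35 * (Real.sin x * W / (Real.cos x ^ 2 * sinDefect x ^ 2)) - N / sinDefect x ^ 3 =
        (Real.sin x * (Real.sin x - x * Real.cos x) * W - 35 * Real.cos x ^ 2 * N) /
          (35 * Real.cos x ^ 2 * sinDefect x ^ 3) := by
      change _ = (Real.sin x * sinDefect x * W - 35 * Real.cos x ^ 2 * N) / _
      field_simp
    rw [this]
    exact div_pos h3 (by positivity)
  linarith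

/-! ### Limits at `0+`. -/

theorem tendsto_sin_div : Tendsto (fun x : ℝ => Real.sin x / x) (𝓝[>] 0) (𝓝 1) := by
  have h : Tendsto Real.sinc (𝓝[>] 0) (𝓝 1) := by
    have := Real.continuous_sinc.tendsto 0
    rw [Real.sinc_zero] at this
    exact this.mono_left nhdsWithin_le_nhds
  refine h.congr' ?_
  filter_upwards [self_mem_nhdsWithin] with x hx
  exact Real.sinc_of_ne_zero (ne_of_gt hx)

theorem tendsto_cos_zero_right : Tendsto Real.cos (𝓝[>] 0) (𝓝 1) := by
  have := Real.continuous_cos.tendsto 0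
  rw [Real.cos_zero] at this
  exact this.mono_left nhdsWithin_le_nhds

theorem tendsto_sinDefect_div : Tendsto (fun x => sinDefect x / x ^ 3) (𝓝[>] 0) (𝓝 (1 / 3)) := by
  refine HasDerivAt.lhopital_zero_nhdsGT (f' := fun x => x * Real.sin x) (g' := fun x => 3 * x ^ 2)
    (Eventually.of_forall hasDerivAt_sinDefect)
    (Eventually.of_forall fun x => by simpa using hasDerivAt_pow 3 x) ?_ ?_ ?_ ?_
  · filter_upwards [self_mem_nhdsWithin] with x hx
    have : (0 : ℝ) < x := hx
    positivity
  · have := (hasDerivAt_sinDefect 0).continuousAt.tendsto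
    simp only [sinDefect, Real.sin_zero, zero_mul, sub_zero] at this
    exact Tendsto.mono_left this nhdsWithin_le_nhds
  · have : Tendsto (fun x : ℝ => x ^ 3) (𝓝 0) (𝓝 (0 ^ 3)) := (continuous_pow 3).tendsto 0
    rw [zero_pow (by norm_num)] at this
    exact this.mono_left nhdsWithin_le_nhds
  · refine (tendsto_sin_div.div_const 3).congr' ?_
    filter_upwards [self_mem_nhdsWithin] with x hx
    have : x ≠ 0 := ne_of_gt hx
    field_simp

theorem eventually_mem_quarter : ∀ᶠ x in 𝓝[>] (0 : ℝ), x ∈ Ioo 0 (Real.pi / 2) :=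
  Ioo_mem_nhdsGT (by positivity)

theorem tendsto_tanRatio : Tendsto tanRatio (𝓝[>] 0) (𝓝 3) := by
  have h := (tendsto_sin_div.pow 2).div (tendsto_cos_zero_right.mul tendsto_sinDefect_div)
    (by norm_num)
  rw [show (1 : ℝ) ^ 2 / (1 * (1 / 3)) = 3 by norm_num] at h
  refine h.congr' ?_
  filter_upwards [eventually_mem_quarter] with x hx
  have := hx.1.ne'
  have := (cos_pos_of_mem_quarter hx).ne'
  have := (sinDefect_pos hx).ne'
  simp only [Pi.div_apply, tanRatio]
  field_simp

/-- The left side is `(defectRatio x - 2/5) * sinDefect x ^ 2` where `sinDefect x ≠ 0`. Since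
`sinDefect x ^ 2` has order `x ^ 6`, bounds 0 and `x ^ 8` suffice for the limit of `defectRatio`. -/
theorem defect_quadratic_eq (x : ℝ) :
    x ^ 2 - 2 * Real.sin x ^ 2 + x * Real.sin x * Real.cos x -
      2 / 5 * (Real.sin x - x * Real.cos x) ^ 2 =
      4 / 5 * x ^ 2 + 6 / 5 * Real.cos (2 * x) - 6 / 5 + 9 / 10 * x * Real.sin (2 * x) -
        1 / 5 * x ^ 2 * Real.cos (2 * x) := by
  rw [Real.sin_two_mul, Real.cos_two_mul]
  have h2 : Real.sin x ^ 2 = 1 - Real.cos x ^ 2 := Real.sin_sq x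
  ring_nf
  simp only [h2]
  ring

theorem defect_quadratic_nonneg {x : ℝ} (hx : 0 < x) (hx2 : x < Real.pi / 2) :
    0 ≤ x ^ 2 - 2 * Real.sin x ^ 2 + x * Real.sin x * Real.cos x -
      2 / 5 * (Real.sin x - x * Real.cos x) ^ 2 := by
  rw [defect_quadratic_eq]
  have hsq := sq_lt_of_lt_pi_div_two hx hx2
  have hx0 := hx.le
  have h2 : 0 ≤ 2 * x := by positivity
  have e0 : 0 ≤ Real.cos (2 * x) - cosTaylor 6 (2 * x) :=
    sub_nonneg.2 (cosTaylor_le_cos (n := 5) (by decide) h2)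
  have e1 : 0 ≤ x * (Real.sin (2 * x) - sinTaylor 6 (2 * x)) :=
    mul_nonneg (by positivity) (sub_nonneg.2 (sinTaylor_le_sin (n := 5) (by decide) h2))
  have e2 : 0 ≤ x ^ 2 * (cosTaylor 5 (2 * x) - Real.cos (2 * x)) :=
    mul_nonneg (by positivity) (sub_nonneg.2 (cos_le_cosTaylor (n := 4) (by decide) h2))
  have hp : 0 ≤ x ^ 8 * (4 / 1575 - 8 / 23625 * x ^ 2 - 4 / 86625 * x ^ 4) := by
    refine mul_nonneg (by positivity) ?_
    nlinarith [sq_nonneg x]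
  simp only [cosTaylor, sinTaylor, Finset.sum_range_succ, Finset.sum_range_zero, Nat.factorial]
    at e0 e1 e2
  push_cast at e0 e1 e2
  linarith [e0, e1, e2, hp]

theorem defect_quadratic_le {x : ℝ} (hx : 0 < x) (hx2 : x < Real.pi / 2) :
    x ^ 2 - 2 * Real.sin x ^ 2 + x * Real.sin x * Real.cos x -
      2 / 5 * (Real.sin x - x * Real.cos x) ^ 2 ≤ x ^ 8 := by
  rw [defect_quadratic_eq]
  have hsq := sq_lt_of_lt_pi_div_two hx hx2
  have hx0 := hx.le
  have h2 : 0 ≤ 2 * x := by positivity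
  have e0 : 0 ≤ cosTaylor 5 (2 * x) - Real.cos (2 * x) :=
    sub_nonneg.2 (cos_le_cosTaylor (n := 4) (by decide) h2)
  have e1 : 0 ≤ x * (sinTaylor 5 (2 * x) - Real.sin (2 * x)) :=
    mul_nonneg (by positivity) (sub_nonneg.2 (sin_le_sinTaylor (n := 4) (by decide) h2))
  have e2 : 0 ≤ x ^ 2 * (Real.cos (2 * x) - cosTaylor 4 (2 * x)) :=
    mul_nonneg (by positivity) (sub_nonneg.2 (cosTaylor_le_cos (n := 3) (by decide) h2))
  have hp : 0 ≤ x ^ 8 * (1 - (4 / 1575 + 2 / 1575 * x ^ 2)) := by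
    refine mul_nonneg (by positivity) ?_
    nlinarith [sq_nonneg x]
  simp only [cosTaylor, sinTaylor, Finset.sum_range_succ, Finset.sum_range_zero, Nat.factorial]
    at e0 e1 e2
  push_cast at e0 e1 e2
  linarith [e0, e1, e2, hp]

theorem tendsto_defectRatio : Tendsto defectRatio (𝓝[>] 0) (𝓝 (2 / 5)) := by
  have h0 : Tendsto (fun x : ℝ => (x ^ 2 - 2 * Real.sin x ^ 2 + x * Real.sin x * Real.cos x -
      2 / 5 * (Real.sin x - x * Real.cos x) ^ 2) / x ^ 6) (𝓝[>] 0) (𝓝 0) := by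
    have hx2 : Tendsto (fun x : ℝ => x ^ 2) (𝓝[>] 0) (𝓝 0) := by
      have : Tendsto (fun x : ℝ => x ^ 2) (𝓝 0) (𝓝 (0 ^ 2)) := (continuous_pow 2).tendsto 0
      rw [zero_pow (by norm_num)] at this
      exact this.mono_left nhdsWithin_le_nhds
    refine tendsto_of_tendsto_of_tendsto_of_le_of_le' tendsto_const_nhds hx2 ?_ ?_
    · filter_upwards [eventually_mem_quarter] with x hx
      exact div_nonneg (defect_quadratic_nonneg hx.1 hx.2) (pow_nonneg hx.1.le 6)
    · filter_upwards [eventually_mem_quarter] with x hx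
      rw [div_le_iff₀ (pow_pos hx.1 6), ← pow_add]
      exact defect_quadratic_le hx.1 hx.2
  have h := (h0.div (tendsto_sinDefect_div.pow 2) (by norm_num)).const_add (2 / 5)
  rw [zero_div, add_zero] at h
  refine h.congr' ?_
  filter_upwards [eventually_mem_quarter] with x hx
  have := hx.1.ne'
  have hd := (sinDefect_pos hx).ne'
  simp only [Pi.div_apply, defectRatio]
  change 2 / 5 + (x ^ 2 - 2 * Real.sin x ^ 2 + x * Real.sin x * Real.cos x -
    2 / 5 * sinDefect x ^ 2) / x ^ 6 / (sinDefect x / x ^ 3) ^ 2 = _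
  have hxc : x * Real.cos x = Real.sin x - sinDefect x := by simp [sinDefect]
  -- Pythagoras times `x²`, with `x cos x` replaced by `sin x - sinDefect x`.
  have hx2 : x ^ 2 = x ^ 2 * Real.sin x ^ 2 + (Real.sin x - sinDefect x) ^ 2 := by
    rw [← hxc, mul_pow, ← mul_add, Real.sin_sq_add_cos_sq, mul_one]
  rw [show x ^ 2 - 2 * Real.sin x ^ 2 + x * Real.sin x * Real.cos x -
    2 / 5 * sinDefect x ^ 2 = x ^ 2 * Real.sin x ^ 2 - 3 * Real.sin x * sinDefect x +
      3 / 5 * sinDefect x ^ 2 by linear_combination hx2 + Real.sin x * hxc]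
  field_simp
  ring

theorem tendsto_slopeSign (p q : ℝ) :
    Tendsto (slopeSign p q) (𝓝[>] 0) (𝓝 (3 * q - p - 8 / 5)) := by
  have h := ((tendsto_tanRatio.const_mul (q - 1)).sub_const (p - 1)).add tendsto_defectRatio
  rwa [show (q - 1) * 3 - (p - 1) + 2 / 5 = 3 * q - p - 8 / 5 by ring] at h

/-! ### Sign criteria from the mean value theorem. -/

/-- One-sided limits replace endpoint values, since the functions used here are controlled only
inside the interval. -/
theorem exists_sub_mul_deriv_eq {f f' : ℝ → ℝ} {a b u v : ℝ} (hab : a < b)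
    (hf : ∀ x ∈ Ioo a b, HasDerivAt f (f' x) x) (hu : Tendsto f (𝓝[>] a) (𝓝 u))
    (hv : Tendsto f (𝓝[<] b) (𝓝 v)) : ∃ c ∈ Ioo a b, (b - a) * f' c = v - u := by
  obtain ⟨c, hc, h⟩ := exists_ratio_hasDerivAt_eq_ratio_slope' f f' hab id (fun _ => 1)
    hf (fun x _ => hasDerivAt_id x) hu (tendsto_id.mono_left nhdsWithin_le_nhds)
    hv (tendsto_id.mono_left nhdsWithin_le_nhds)
  exact ⟨c, hc, by linarith⟩

theorem HasDerivAt.tendsto_left {f : ℝ → ℝ} {d x : ℝ} (h : HasDerivAt f d x) :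
    Tendsto f (𝓝[<] x) (𝓝 (f x)) := h.continuousAt.tendsto.mono_left nhdsWithin_le_nhds

theorem HasDerivAt.tendsto_right {f : ℝ → ℝ} {d x : ℝ} (h : HasDerivAt f d x) :
    Tendsto f (𝓝[>] x) (𝓝 (f x)) := h.continuousAt.tendsto.mono_left nhdsWithin_le_nhds

theorem pos_of_tendsto_zero_of_deriv_pos {f f' : ℝ → ℝ} {b : ℝ}
    (hf : ∀ x ∈ Ioo 0 b, HasDerivAt f (f' x) x) (h0 : Tendsto f (𝓝[>] 0) (𝓝 0))
    (hf' : ∀ x ∈ Ioo 0 b, 0 < f' x) : ∀ x ∈ Ioo 0 b, 0 < f x := by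
  intro x hx
  obtain ⟨c, hc, h⟩ := exists_sub_mul_deriv_eq hx.1
    (fun y hy => hf y ⟨hy.1, hy.2.trans hx.2⟩) h0 (hf x hx).tendsto_left
  have := mul_pos hx.1 (hf' c ⟨hc.1, hc.2.trans hx.2⟩)
  linarith

theorem StrictMonoOn.pos_of_tendsto_zero {G : ℝ → ℝ} {b : ℝ} (hG : StrictMonoOn G (Ioo 0 b))
    (h0 : Tendsto G (𝓝[>] 0) (𝓝 0)) : ∀ x ∈ Ioo 0 b, 0 < G x := by
  intro x hx
  have hy : x / 2 ∈ Ioo 0 b := ⟨by linarith [hx.1], by linarith [hx.1, hx.2]⟩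
  have h1 : 0 ≤ G (x / 2) := by
    refine le_of_tendsto h0 ?_
    filter_upwards [Ioo_mem_nhdsGT hy.1] with z hz
    exact (hG ⟨hz.1, hz.2.trans hy.2⟩ hy hz.2).le
  exact h1.trans_lt (hG hy hx (by linarith [hx.1]))

/-- If `h` starts from `0` and increases, a function with derivative `φ (1 - exp h)` that starts
from `0` is negative. -/
theorem neg_of_logSlope_pos {F φ h A G : ℝ → ℝ} {b : ℝ}
    (hF : ∀ x ∈ Ioo 0 b, HasDerivAt F (φ x * (1 - Real.exp (h x))) x)
    (hφ : ∀ x ∈ Ioo 0 b, 0 < φ x)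
    (hh : ∀ x ∈ Ioo 0 b, HasDerivAt h (A x * G x) x) (hA : ∀ x ∈ Ioo 0 b, 0 < A x)
    (hG : ∀ x ∈ Ioo 0 b, 0 < G x)
    (hF0 : Tendsto F (𝓝[>] 0) (𝓝 0)) (hh0 : Tendsto h (𝓝[>] 0) (𝓝 0)) :
    ∀ x ∈ Ioo 0 b, F x < 0 := by
  have hpos := pos_of_tendsto_zero_of_deriv_pos hh hh0 fun x hx => mul_pos (hA x hx) (hG x hx)
  have h0 : Tendsto (fun x => -F x) (𝓝[>] 0) (𝓝 0) := by simpa using hF0.neg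
  have := pos_of_tendsto_zero_of_deriv_pos (fun x hx => (hF x hx).neg) h0 fun x hx => by
    have := mul_pos (hφ x hx) (sub_pos.2 (Real.one_lt_exp_iff.2 (hpos x hx)))
    linarith
  intro x hx
  exact neg_pos.1 (this x hx)

/-- If the derivative of `h` has the sign of an increasing function, then a function with derivative
`φ (1 - exp h)` that vanishes at both ends is positive. -/
theorem pos_of_logSlope_strictMono {F φ h A G : ℝ → ℝ} {b : ℝ}
    (hF : ∀ x ∈ Ioo 0 b, HasDerivAt F (φ x * (1 - Real.exp (h x))) x)
    (hφ : ∀ x ∈ Ioo 0 b, 0 < φ x)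
    (hh : ∀ x ∈ Ioo 0 b, HasDerivAt h (A x * G x) x) (hA : ∀ x ∈ Ioo 0 b, 0 < A x)
    (hG : StrictMonoOn G (Ioo 0 b))
    (hF0 : Tendsto F (𝓝[>] 0) (𝓝 0)) (hh0 : Tendsto h (𝓝[>] 0) (𝓝 0))
    (hFb : Tendsto F (𝓝[<] b) (𝓝 0)) :
    ∀ x ∈ Ioo 0 b, 0 < F x := by
  intro x hx
  by_contra! hle
  -- If `F x ≤ 0`, then `h y ≥ 0` for some `y < x`, hence `G w ≥ 0` for some `w < y`. Beyond `w` the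
  -- function `G` is positive, so `h > 0` beyond `y` and `F` falls strictly from `x` on, which
  -- contradicts its limit 0 at `b`.
  obtain ⟨y, hy, hFy⟩ := exists_sub_mul_deriv_eq hx.1
    (fun z hz => hF z ⟨hz.1, hz.2.trans hx.2⟩) hF0 (hF x hx).tendsto_left
  have hyb : y ∈ Ioo 0 b := ⟨hy.1, hy.2.trans hx.2⟩
  have hhy : 0 ≤ h y := by
    by_contra! hneg
    have := mul_pos hx.1 (mul_pos (hφ y hyb) (sub_pos.2 (Real.exp_lt_one_iff.2 hneg)))
    linarith
  obtain ⟨w, hw, hhw⟩ := exists_sub_mul_deriv_eq hy.1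
    (fun z hz => hh z ⟨hz.1, hz.2.trans hyb.2⟩) hh0 (hh y hyb).tendsto_left
  have hwb : w ∈ Ioo 0 b := ⟨hw.1, hw.2.trans hyb.2⟩
  have hGw : 0 ≤ G w := by
    by_contra! hneg
    have := mul_pos hy.1 (mul_pos (hA w hwb) (neg_pos.2 hneg))
    linarith
  have hpos : ∀ z ∈ Ioo y b, 0 < h z := by
    intro z hz
    have hzb : z ∈ Ioo 0 b := ⟨hy.1.trans hz.1, hz.2⟩
    obtain ⟨v, hv, hhv⟩ := exists_sub_mul_deriv_eq hz.1
      (fun t ht => hh t ⟨hy.1.trans ht.1, ht.2.trans hz.2⟩) (hh y hyb).tendsto_right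
      (hh z hzb).tendsto_left
    have hvb : v ∈ Ioo 0 b := ⟨hy.1.trans hv.1, hv.2.trans hz.2⟩
    have := mul_pos (sub_pos.2 hz.1)
      (mul_pos (hA v hvb) (hGw.trans_lt (hG hwb hvb (hw.2.trans hv.1))))
    linarith
  obtain ⟨v, hv, hFv⟩ := exists_sub_mul_deriv_eq hx.2
    (fun t ht => hF t ⟨hx.1.trans ht.1, ht.2⟩) (hF x hx).tendsto_right hFb
  have := mul_pos (sub_pos.2 hx.2) (mul_pos (hφ v ⟨hx.1.trans hv.1, hv.2⟩)
    (sub_pos.2 (Real.one_lt_exp_iff.2 (hpos v ⟨hy.2.trans hv.1, hv.2⟩))))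
  linarith

/-- The class of functions with derivative `φ (1 - exp h)` is closed under negation, with `h`
replaced by `-h`; each criterion thus serves both signs. -/
theorem hasDerivAt_neg_logSlope {F φ h : ℝ → ℝ} {x : ℝ}
    (hF : HasDerivAt F (φ x * (1 - Real.exp (h x))) x) :
    HasDerivAt (fun x => -F x) (φ x * Real.exp (h x) * (1 - Real.exp (-h x))) x := by
  refine hF.neg.congr_deriv ?_
  rw [Real.exp_neg]
  have := (Real.exp_pos (h x)).ne'
  field_simp
  ring

/-! ### The power transform and the reduction to `cusaGap`. -/

/-- The function `(y ^ p - 1) / p`, extended by `log y` to `p = 0`. -/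
noncomputable def boxCox (p y : ℝ) : ℝ := if p = 0 then Real.log y else (y ^ p - 1) / p

theorem boxCox_one (p : ℝ) : boxCox p 1 = 0 := by simp [boxCox]

theorem hasDerivAt_boxCox (p : ℝ) {y : ℝ} (hy : 0 < y) :
    HasDerivAt (boxCox p) (y ^ (p - 1)) y := by
  unfold boxCox
  by_cases hp : p = 0
  · simp only [hp, if_true, zero_sub, Real.rpow_neg_one]
    exact Real.hasDerivAt_log hy.ne'
  · simp only [hp, if_false]
    refine (((Real.hasDerivAt_rpow_const (Or.inl hy.ne')).sub_const 1).div_const p).congr_deriv ?_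
    field_simp

theorem strictMonoOn_boxCox (p : ℝ) : StrictMonoOn (boxCox p) (Ioi 0) := by
  refine strictMonoOn_of_deriv_pos (convex_Ioi 0)
    (fun y hy => (hasDerivAt_boxCox p hy).continuousAt.continuousWithinAt) fun y hy => ?_
  rw [interior_Ioi] at hy
  rw [(hasDerivAt_boxCox p hy).deriv]
  exact Real.rpow_pos_of_pos hy _

theorem boxCox_lt_boxCox_iff (p : ℝ) {y z : ℝ} (hy : 0 < y) (hz : 0 < z) :
    boxCox p y < boxCox p z ↔ y < z := (strictMonoOn_boxCox p).lt_iff_lt hy hz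

theorem boxCox_neg (p : ℝ) {y : ℝ} (hy : 0 < y) (hy1 : y < 1) : boxCox p y < 0 := by
  rw [← boxCox_one p]
  exact (boxCox_lt_boxCox_iff p hy one_pos).2 hy1

/-- The difference of two transforms vanishes at 1 and has derivative `z^(q-1) - z^(p-1) < 0` on
`(0, 1)` for `p < q`. -/
theorem boxCox_strictMono_exponent {y : ℝ} (hy : 0 < y) (hy1 : y < 1) :
    StrictMono fun p => boxCox p y := by
  intro p q hpq
  have h : StrictAntiOn (fun z => boxCox q z - boxCox p z) (Ioc 0 1) := by
    have hd : ∀ z : ℝ, 0 < z → HasDerivAt (fun z => boxCox q z - boxCox p z)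
        (z ^ (q - 1) - z ^ (p - 1)) z :=
      fun z hz => (hasDerivAt_boxCox q hz).sub (hasDerivAt_boxCox p hz)
    refine strictAntiOn_of_deriv_neg (convex_Ioc 0 1)
      (fun z hz => (hd z hz.1).continuousAt.continuousWithinAt) fun z hz => ?_
    rw [interior_Ioc] at hz
    rw [(hd z hz.1).deriv]
    have := Real.rpow_lt_rpow_of_exponent_gt hz.1 hz.2 (show p - 1 < q - 1 by linarith)
    linarith
  have := h ⟨hy, hy1.le⟩ ⟨one_pos, le_rfl⟩ hy1
  simp only [boxCox_one] at this
  change boxCox p y < boxCox q y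
  linarith

/-- Admissibility makes the base positive: it exceeds 1 when `p < 0`, because `boxCox q t < 0`, and
for `p > 0` the weight `p/(3q)` lies in `(0, 1]`. -/
theorem cusaBound_pos_and_boxCox {t p q : ℝ} (ht : 0 < t) (ht1 : t < 1)
    (hpq : (p, q) ∈ admissibleRegion) :
    0 < cusaBound t p q ∧ boxCox p (cusaBound t p q) = boxCox q t / 3 := by
  have hpq' : p ≤ 0 ∨ (0 < p ∧ p ≤ 3 * q) := hpq
  unfold cusaBound
  by_cases hp : p = 0
  · by_cases hq : q = 0
    · simp only [hp, hq, if_true, boxCox]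
      refine ⟨Real.rpow_pos_of_pos ht _, ?_⟩
      rw [Real.log_rpow ht]
      ring
    · simp only [hp, hq, if_true, if_false, boxCox]
      refine ⟨Real.exp_pos _, ?_⟩
      rw [Real.log_exp]
      field_simp
  · have key : ∀ b : ℝ, 0 < b → (b - 1) / p = boxCox q t / 3 →
        0 < b ^ (1 / p) ∧ boxCox p (b ^ (1 / p)) = boxCox q t / 3 := by
      intro b hb h
      refine ⟨Real.rpow_pos_of_pos hb _, ?_⟩
      rw [← h, boxCox, if_neg hp, ← Real.rpow_mul hb.le, one_div_mul_cancel hp, Real.rpow_one]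
    have hneg := boxCox_neg q ht ht1
    have pos : ∀ b : ℝ, p < 0 → (b - 1) / p = boxCox q t / 3 → 0 < b := by
      intro b hp0 h
      have h1 : (b - 1) / p < 0 := by linarith
      rcases div_neg_iff.1 h1 with h2 | h2 <;> linarith
    by_cases hq : q = 0
    · simp only [hp, hq, if_true, if_false]
      have hb : (p / 3 * Real.log t + 1 - 1) / p = boxCox q t / 3 := by
        simp only [boxCox, hq, if_true]
        field_simp
        ring
      rw [hq] at hb key pos
      refine key _ (pos _ ?_ hb) hb
      rcases hpq' with h | h
      · exact lt_of_le_of_ne h hp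
      · rw [hq] at h; linarith
    · simp only [hp, hq, if_false]
      have hb : (1 - p / (3 * q) + p / (3 * q) * t ^ q - 1) / p = boxCox q t / 3 := by
        simp only [boxCox, hq, if_false]
        field_simp
        ring
      refine key _ ?_ hb
      rcases hpq' with h | h
      · exact pos _ (lt_of_le_of_ne h hp) hb
      · have hq0 : 0 < q := by linarith
        have h1 : p / (3 * q) ≤ 1 := by rw [div_le_one (by positivity)]; exact h.2
        have h2 : 0 < p / (3 * q) * t ^ q :=
          mul_pos (div_pos h.1 (by positivity)) (Real.rpow_pos_of_pos ht q)
        linarith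

/-- The difference of the transformed sides of the inequality. -/
noncomputable def cusaGap (p q x : ℝ) : ℝ :=
  boxCox p (Real.sin x / x) - boxCox q (Real.cos x) / 3

theorem cos_lt_one_of_mem_quarter {x : ℝ} (hx : x ∈ Ioo 0 (Real.pi / 2)) : Real.cos x < 1 := by
  have h1 := sin_pos_of_mem_quarter hx
  nlinarith [Real.sin_sq_add_cos_sq x, cos_pos_of_mem_quarter hx]

theorem lt_cusaBound_iff {p q x : ℝ} (hpq : (p, q) ∈ admissibleRegion)
    (hx : x ∈ Ioo 0 (Real.pi / 2)) :
    Real.sin x / x < cusaBound (Real.cos x) p q ↔ cusaGap p q x < 0 := by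
  obtain ⟨h1, h2⟩ := cusaBound_pos_and_boxCox (cos_pos_of_mem_quarter hx)
    (cos_lt_one_of_mem_quarter hx) hpq
  rw [← boxCox_lt_boxCox_iff p (div_pos (sin_pos_of_mem_quarter hx) hx.1) h1, h2, cusaGap, sub_neg]

theorem cusaBound_lt_iff {p q x : ℝ} (hpq : (p, q) ∈ admissibleRegion)
    (hx : x ∈ Ioo 0 (Real.pi / 2)) :
    cusaBound (Real.cos x) p q < Real.sin x / x ↔ 0 < cusaGap p q x := by
  obtain ⟨h1, h2⟩ := cusaBound_pos_and_boxCox (cos_pos_of_mem_quarter hx)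
    (cos_lt_one_of_mem_quarter hx) hpq
  rw [← boxCox_lt_boxCox_iff p h1 (div_pos (sin_pos_of_mem_quarter hx) hx.1), h2, cusaGap, sub_pos]

theorem forall_lt_cusaBound_iff {p q : ℝ} (hpq : (p, q) ∈ admissibleRegion) :
    (∀ x ∈ Ioo (0 : ℝ) (Real.pi / 2), Real.sin x / x < cusaBound (Real.cos x) p q) ↔
      ∀ x ∈ Ioo 0 (Real.pi / 2), cusaGap p q x < 0 :=
  forall₂_congr fun _ hx => lt_cusaBound_iff hpq hx

theorem forall_cusaBound_lt_iff {p q : ℝ} (hpq : (p, q) ∈ admissibleRegion) :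
    (∀ x ∈ Ioo (0 : ℝ) (Real.pi / 2), cusaBound (Real.cos x) p q < Real.sin x / x) ↔
      ∀ x ∈ Ioo 0 (Real.pi / 2), 0 < cusaGap p q x :=
  forall₂_congr fun _ hx => cusaBound_lt_iff hpq hx

theorem cusaGap_anti (p : ℝ) {q q' x : ℝ} (hq : q ≤ q') (hx : x ∈ Ioo 0 (Real.pi / 2)) :
    cusaGap p q' x ≤ cusaGap p q x := by
  have := (boxCox_strictMono_exponent (cos_pos_of_mem_quarter hx)
    (cos_lt_one_of_mem_quarter hx)).monotone hq
  unfold cusaGap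
  linarith

theorem tendsto_cusaGap_zero (p q : ℝ) : Tendsto (cusaGap p q) (𝓝[>] 0) (𝓝 0) := by
  have h : ∀ r, Tendsto (boxCox r) (𝓝 1) (𝓝 0) := fun r => by
    have := (hasDerivAt_boxCox r one_pos).continuousAt.tendsto
    rwa [boxCox_one] at this
  have := ((h p).comp tendsto_sin_div).sub (((h q).comp tendsto_cos_zero_right).div_const 3)
  rwa [zero_div, sub_zero] at this

/-- Positivity of `q` makes `cos x ^ q` vanish at `π/2`. The limit is 0 for `q = critExponent p`. -/
theorem tendsto_cusaGap_right (p : ℝ) {q : ℝ} (hq : 0 < q) :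
    Tendsto (cusaGap p q) (𝓝[<] (Real.pi / 2)) (𝓝 (boxCox p (2 / Real.pi) + 1 / (3 * q))) := by
  have hpi := Real.pi_pos
  have h1 : ContinuousAt (fun x => boxCox p (Real.sin x / x)) (Real.pi / 2) := by
    refine ContinuousAt.comp (g := boxCox p)
      (hasDerivAt_boxCox p (y := Real.sin (Real.pi / 2) / (Real.pi / 2)) ?_).continuousAt ?_
    · rw [Real.sin_pi_div_two]; positivity
    · exact Real.continuous_sin.continuousAt.div continuousAt_id (by positivity)
  have h2 : ContinuousAt (fun x => (Real.cos x ^ q - 1) / q / 3) (Real.pi / 2) :=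
    (((Real.continuous_cos.continuousAt.rpow_const (Or.inr hq.le)).sub_const 1).div_const
      q).div_const 3
  have h := (h1.sub h2).tendsto
  simp only [Pi.sub_apply, Real.sin_pi_div_two, Real.cos_pi_div_two, Real.zero_rpow hq.ne',
    one_div_div] at h
  have hfun : cusaGap p q = fun x => boxCox p (Real.sin x / x) - (Real.cos x ^ q - 1) / q / 3 := by
    ext x
    simp [cusaGap, boxCox, hq.ne']
  rw [hfun]
  rw [show boxCox p (2 / Real.pi) + 1 / (3 * q) = boxCox p (2 / Real.pi) - (0 - 1) / q / 3 by
    field_simp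
    ring]
  exact h.mono_left nhdsWithin_le_nhds

/-! ### Derivatives of the gap and of `logSlope`. -/

/-- The logarithm of three times the quotient of the derivatives of the two transformed sides. -/
noncomputable def logSlope (p q x : ℝ) : ℝ :=
  (p - 1) * Real.log (Real.sin x / x) + Real.log (3 * sinDefect x / (x ^ 2 * Real.sin x)) +
    (1 - q) * Real.log (Real.cos x)

theorem hasDerivAt_sin_div {x : ℝ} (hx : 0 < x) :
    HasDerivAt (fun x => Real.sin x / x) (-sinDefect x / x ^ 2) x := by
  refine ((Real.hasDerivAt_sin x).div (hasDerivAt_id x) hx.ne').congr_deriv ?_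
  simp [sinDefect]
  ring

theorem hasDerivAt_logSlope (p q : ℝ) {x : ℝ} (hx : x ∈ Ioo 0 (Real.pi / 2)) :
    HasDerivAt (logSlope p q) (sinDefect x / (x * Real.sin x) * slopeSign p q x) x := by
  have hx0 := hx.1
  have hs := sin_pos_of_mem_quarter hx
  have hc := cos_pos_of_mem_quarter hx
  have hd := sinDefect_pos hx
  have h1 := ((hasDerivAt_sin_div hx0).log (div_pos hs hx0).ne').const_mul (p - 1)
  have h2 := (((hasDerivAt_sinDefect x).const_mul 3).div
    ((hasDerivAt_pow 2 x).mul (Real.hasDerivAt_sin x))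
    (by simp only [Pi.mul_apply]; positivity)).log
    (by simp only [Pi.div_apply, Pi.mul_apply]; positivity)
  have h3 := ((Real.hasDerivAt_cos x).log hc.ne').const_mul (1 - q)
  refine ((h1.add h2).add h3).congr_deriv ?_
  simp only [Pi.div_apply, Pi.mul_apply, slopeSign, tanRatio, defectRatio]
  -- Eliminating `cos x` in favour of `sinDefect x` leaves a rational identity.
  have hxc : x * Real.cos x = Real.sin x - sinDefect x := by simp [sinDefect]
  have hxc' : Real.cos x = (Real.sin x - sinDefect x) / x := by
    rw [← hxc, mul_div_cancel_left₀ _ hx0.ne']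
  have hne : Real.sin x - sinDefect x ≠ 0 := by rw [← hxc]; positivity
  rw [hxc']
  field_simp
  ring

theorem hasDerivAt_cusaGap (p q : ℝ) {x : ℝ} (hx : x ∈ Ioo 0 (Real.pi / 2)) :
    HasDerivAt (cusaGap p q)
      (Real.cos x ^ (q - 1) * Real.sin x / 3 * (1 - Real.exp (logSlope p q x))) x := by
  have hx0 := hx.1
  have hs := sin_pos_of_mem_quarter hx
  have hc := cos_pos_of_mem_quarter hx
  have hd := sinDefect_pos hx
  have h1 := (hasDerivAt_boxCox p (div_pos hs hx0)).comp (h := fun x => Real.sin x / x) x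
    (hasDerivAt_sin_div hx0)
  have h2 := ((hasDerivAt_boxCox q hc).comp x (Real.hasDerivAt_cos x)).div_const 3
  refine (h1.sub h2).congr_deriv ?_
  have hexp : Real.exp (logSlope p q x) = (Real.sin x / x) ^ (p - 1) *
      (3 * sinDefect x / (x ^ 2 * Real.sin x)) * Real.cos x ^ (1 - q) := by
    rw [logSlope, Real.exp_add, Real.exp_add, Real.exp_log (by positivity),
      Real.rpow_def_of_pos (div_pos hs hx0), Real.rpow_def_of_pos hc, mul_comm (p - 1),
      mul_comm (1 - q)]
  have hcc : Real.cos x ^ (q - 1) * Real.cos x ^ (1 - q) = 1 := by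
    rw [← Real.rpow_add hc]; simp
  rw [hexp]
  have : Real.cos x ^ (q - 1) * Real.sin x / 3 * (1 - (Real.sin x / x) ^ (p - 1) *
      (3 * sinDefect x / (x ^ 2 * Real.sin x)) * Real.cos x ^ (1 - q)) =
      Real.cos x ^ (q - 1) * Real.sin x / 3 - (Real.cos x ^ (q - 1) * Real.cos x ^ (1 - q)) *
        ((Real.sin x / x) ^ (p - 1) * (sinDefect x / x ^ 2)) := by
    field_simp
  rw [this, hcc]
  ring

theorem tendsto_logSlope (p q : ℝ) : Tendsto (logSlope p q) (𝓝[>] 0) (𝓝 0) := by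
  have hlog : ∀ {f : ℝ → ℝ}, Tendsto f (𝓝[>] 0) (𝓝 1) →
      Tendsto (fun x => Real.log (f x)) (𝓝[>] 0) (𝓝 0) := fun h => by
    have := h.log one_ne_zero
    rwa [Real.log_one] at this
  have h : Tendsto (fun x => 3 * sinDefect x / (x ^ 2 * Real.sin x)) (𝓝[>] 0) (𝓝 1) := by
    have := (tendsto_sinDefect_div.const_mul 3).div tendsto_sin_div one_ne_zero
    rw [show (3 : ℝ) * (1 / 3) / 1 = 1 by norm_num] at this
    refine this.congr' ?_
    filter_upwards [eventually_mem_quarter] with x hx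
    have := hx.1.ne'
    have := (sin_pos_of_mem_quarter hx).ne'
    simp only [Pi.div_apply]
    field_simp
  have h0 := (((hlog tendsto_sin_div).const_mul (p - 1)).add (hlog h)).add
    ((hlog tendsto_cos_zero_right).const_mul (1 - q))
  rwa [mul_zero, mul_zero, add_zero, add_zero] at h0

/-- The free endpoint `b` allows use on the whole interval for sufficiency and near 0 for necessity.
-/
theorem cusaGap_neg_of_slopeSign_pos {p q b : ℝ} (hb : b ≤ Real.pi / 2)
    (h : ∀ x ∈ Ioo 0 b, 0 < slopeSign p q x) : ∀ x ∈ Ioo 0 b, cusaGap p q x < 0 := by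
  have hsub : ∀ {x}, x ∈ Ioo 0 b → x ∈ Ioo 0 (Real.pi / 2) := fun hx => ⟨hx.1, hx.2.trans_le hb⟩
  exact neg_of_logSlope_pos
    (fun x hx => hasDerivAt_cusaGap p q (hsub hx))
    (fun x hx => div_pos (mul_pos (Real.rpow_pos_of_pos (cos_pos_of_mem_quarter (hsub hx)) _)
      (sin_pos_of_mem_quarter (hsub hx))) three_pos)
    (fun x hx => hasDerivAt_logSlope p q (hsub hx))
    (fun x hx => div_pos (sinDefect_pos (hsub hx))
      (mul_pos hx.1 (sin_pos_of_mem_quarter (hsub hx))))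
    h (tendsto_cusaGap_zero p q) (tendsto_logSlope p q)

theorem cusaGap_pos_of_slopeSign_neg {p q b : ℝ} (hb : b ≤ Real.pi / 2)
    (h : ∀ x ∈ Ioo 0 b, slopeSign p q x < 0) : ∀ x ∈ Ioo 0 b, 0 < cusaGap p q x := by
  have hsub : ∀ {x}, x ∈ Ioo 0 b → x ∈ Ioo 0 (Real.pi / 2) := fun hx => ⟨hx.1, hx.2.trans_le hb⟩
  intro x hx
  refine neg_neg_iff_pos.1 (neg_of_logSlope_pos
    (fun x hx => hasDerivAt_neg_logSlope
      (φ := fun x => Real.cos x ^ (q - 1) * Real.sin x / 3) (hasDerivAt_cusaGap p q (hsub hx)))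
    (fun x hx => mul_pos (div_pos (mul_pos
      (Real.rpow_pos_of_pos (cos_pos_of_mem_quarter (hsub hx)) _)
      (sin_pos_of_mem_quarter (hsub hx))) three_pos) (Real.exp_pos _))
    (fun x hx => ((hasDerivAt_logSlope p q (hsub hx)).neg.congr_deriv (mul_neg _ _).symm))
    (fun x hx => div_pos (sinDefect_pos (hsub hx))
      (mul_pos hx.1 (sin_pos_of_mem_quarter (hsub hx))))
    (fun x hx => neg_pos.2 (h x hx)) (by simpa using (tendsto_cusaGap_zero p q).neg)
    (by simpa using (tendsto_logSlope p q).neg) x hx)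

/-! ### The critical exponent and the boundary cases. -/

theorem critExponent_eq (p : ℝ) : critExponent p = -1 / (3 * boxCox p (2 / Real.pi)) := by
  unfold critExponent boxCox
  by_cases hp : p = 0
  · simp [hp]
  · simp only [hp, if_false]
    -- In this case both sides are divisions by zero, with value 0.
    by_cases h : (2 / Real.pi) ^ p = 1
    · simp [h]
    · have h1 : 1 - (2 / Real.pi) ^ p ≠ 0 := fun h2 => h (by linarith)
      have h3 : (2 / Real.pi) ^ p - 1 ≠ 0 := fun h2 => h (by linarith)
      field_simp
      ring

theorem two_div_pi_pos : 0 < 2 / Real.pi := by positivity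

theorem two_div_pi_lt_one : 2 / Real.pi < 1 := by
  rw [div_lt_one Real.pi_pos]
  exact Real.two_le_pi.lt_of_ne fun h => by linarith [Real.pi_gt_three]

theorem critExponent_pos (p : ℝ) : 0 < critExponent p := by
  rw [critExponent_eq]
  have := boxCox_neg p two_div_pi_pos two_div_pi_lt_one
  exact div_pos_of_neg_of_neg (by norm_num) (by linarith)

theorem boxCox_add_critExponent (p : ℝ) :
    boxCox p (2 / Real.pi) + 1 / (3 * critExponent p) = 0 := by
  rw [critExponent_eq]
  have := (boxCox_neg p two_div_pi_pos two_div_pi_lt_one).ne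
  field_simp
  ring

theorem critExponent_strictMono : StrictMono critExponent := by
  intro p q hpq
  have h1 := boxCox_add_critExponent p
  have h2 := boxCox_add_critExponent q
  have h3 := boxCox_strictMono_exponent two_div_pi_pos two_div_pi_lt_one hpq
  simp only at h3
  have h4 : 1 / (3 * critExponent q) < 1 / (3 * critExponent p) := by linarith
  have := lt_of_one_div_lt_one_div (mul_pos three_pos (critExponent_pos q)) h4
  linarith

theorem cusaGap_pos_of_eq_critExponent {p : ℝ} (hq : 1 ≤ critExponent p) :
    ∀ x ∈ Ioo 0 (Real.pi / 2), 0 < cusaGap p (critExponent p) x := by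
  refine pos_of_logSlope_strictMono
    (fun x hx => hasDerivAt_cusaGap p _ hx)
    (fun x hx => div_pos (mul_pos (Real.rpow_pos_of_pos (cos_pos_of_mem_quarter hx) _)
      (sin_pos_of_mem_quarter hx)) three_pos)
    (fun x hx => hasDerivAt_logSlope p _ hx)
    (fun x hx => div_pos (sinDefect_pos hx)
      (mul_pos hx.1 (sin_pos_of_mem_quarter hx)))
    (strictMonoOn_slopeSign p hq) (tendsto_cusaGap_zero p _) (tendsto_logSlope p _) ?_
  rw [← boxCox_add_critExponent p]
  exact tendsto_cusaGap_right p (critExponent_pos p)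

theorem cusaGap_neg_of_eq_critExponent {p : ℝ} (hq : critExponent p ≤ 34 / 35) :
    ∀ x ∈ Ioo 0 (Real.pi / 2), cusaGap p (critExponent p) x < 0 := by
  have hb : Tendsto (cusaGap p (critExponent p)) (𝓝[<] (Real.pi / 2)) (𝓝 0) := by
    rw [← boxCox_add_critExponent p]
    exact tendsto_cusaGap_right p (critExponent_pos p)
  set q := critExponent p
  intro x hx
  refine neg_pos.1 (pos_of_logSlope_strictMono
    (fun x hx => hasDerivAt_neg_logSlope
      (φ := fun x => Real.cos x ^ (q - 1) * Real.sin x / 3) (hasDerivAt_cusaGap p q hx))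
    (fun x hx => mul_pos (div_pos (mul_pos
      (Real.rpow_pos_of_pos (cos_pos_of_mem_quarter hx) _)
      (sin_pos_of_mem_quarter hx)) three_pos) (Real.exp_pos _))
    (fun x hx => ((hasDerivAt_logSlope p q hx).neg.congr_deriv (mul_neg _ _).symm))
    (fun x hx => div_pos (sinDefect_pos hx)
      (mul_pos hx.1 (sin_pos_of_mem_quarter hx)))
    (strictAntiOn_slopeSign p hq).neg (by simpa using (tendsto_cusaGap_zero p q).neg)
    (by simpa using (tendsto_logSlope p q).neg) (by simpa using hb.neg) x hx)

theorem cusaGap_neg_of_eq_taylorExponent {p q : ℝ} (hpq : q = p / 3 + 8 / 15) (hq : 1 ≤ q) :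
    ∀ x ∈ Ioo 0 (Real.pi / 2), cusaGap p q x < 0 := by
  refine cusaGap_neg_of_slopeSign_pos le_rfl
    ((strictMonoOn_slopeSign p hq).pos_of_tendsto_zero ?_)
  have := tendsto_slopeSign p q
  rwa [show 3 * q - p - 8 / 5 = 0 by rw [hpq]; ring] at this

theorem cusaGap_pos_of_eq_taylorExponent {p q : ℝ} (hpq : q = p / 3 + 8 / 15) (hq : q ≤ 34 / 35) :
    ∀ x ∈ Ioo 0 (Real.pi / 2), 0 < cusaGap p q x := by
  refine cusaGap_pos_of_slopeSign_neg le_rfl fun x hx => neg_pos.1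
    ((strictAntiOn_slopeSign p hq).neg.pos_of_tendsto_zero ?_ x hx)
  have := (tendsto_slopeSign p q).neg
  rwa [show -(3 * q - p - 8 / 5) = 0 by rw [hpq]; ring] at this

/-! ### Necessity, from the two ends of the interval. -/

theorem taylorExponent_le_of_cusaGap_neg {p q : ℝ}
    (h : ∀ x ∈ Ioo 0 (Real.pi / 2), cusaGap p q x < 0) : p / 3 + 8 / 15 ≤ q := by
  by_contra! hlt
  have hev := (tendsto_slopeSign p q).eventually_lt_const (show 3 * q - p - 8 / 5 < 0 by linarith)
  obtain ⟨b, hb, hbs⟩ := mem_nhdsGT_iff_exists_Ioo_subset.1 (hev.and eventually_mem_quarter)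
  have hb0 : (0 : ℝ) < b := hb
  -- Only points inside `(0, b)` are known to lie below `π/2`, so `b / 2` serves as the endpoint.
  have hmid : b / 2 ∈ Ioo 0 b := ⟨by linarith, by linarith⟩
  have hb2 : b / 2 ∈ Ioo 0 (Real.pi / 2) := (hbs hmid).2
  have hq4 : b / 4 ∈ Ioo 0 (b / 2) := ⟨by linarith, by linarith⟩
  have := cusaGap_pos_of_slopeSign_neg hb2.2.le
    (fun x hx => (hbs ⟨hx.1, hx.2.trans hmid.2⟩).1) (b / 4) hq4
  linarith [h (b / 4) ⟨hq4.1, hq4.2.trans hb2.2⟩]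

theorem le_taylorExponent_of_cusaGap_pos {p q : ℝ}
    (h : ∀ x ∈ Ioo 0 (Real.pi / 2), 0 < cusaGap p q x) : q ≤ p / 3 + 8 / 15 := by
  by_contra! hlt
  have hev := (tendsto_slopeSign p q).eventually_const_lt (show 0 < 3 * q - p - 8 / 5 by linarith)
  obtain ⟨b, hb, hbs⟩ := mem_nhdsGT_iff_exists_Ioo_subset.1 (hev.and eventually_mem_quarter)
  have hb0 : (0 : ℝ) < b := hb
  have hmid : b / 2 ∈ Ioo 0 b := ⟨by linarith, by linarith⟩
  have hb2 : b / 2 ∈ Ioo 0 (Real.pi / 2) := (hbs hmid).2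
  have hq4 : b / 4 ∈ Ioo 0 (b / 2) := ⟨by linarith, by linarith⟩
  have := cusaGap_neg_of_slopeSign_pos hb2.2.le
    (fun x hx => (hbs ⟨hx.1, hx.2.trans hmid.2⟩).1) (b / 4) hq4
  linarith [h (b / 4) ⟨hq4.1, hq4.2.trans hb2.2⟩]

theorem eventually_mem_quarter_left :
    ∀ᶠ x in 𝓝[<] (Real.pi / 2), x ∈ Ioo 0 (Real.pi / 2) := Ioo_mem_nhdsLT (by positivity)

theorem le_critExponent_of_cusaGap_pos {p q : ℝ}
    (h : ∀ x ∈ Ioo 0 (Real.pi / 2), 0 < cusaGap p q x) : q ≤ critExponent p := by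
  by_contra! hlt
  have hc := critExponent_pos p
  have h1 := ge_of_tendsto (tendsto_cusaGap_right p (hc.trans hlt))
    (eventually_mem_quarter_left.mono fun x hx => (h x hx).le)
  have h2 := boxCox_add_critExponent p
  have h3 : 1 / (3 * q) < 1 / (3 * critExponent p) :=
    one_div_lt_one_div_of_lt (by linarith) (by linarith)
  linarith

theorem critExponent_le_of_cusaGap_neg {p q : ℝ}
    (h : ∀ x ∈ Ioo 0 (Real.pi / 2), cusaGap p q x < 0) : critExponent p ≤ q := by
  by_contra! hlt
  have hc := critExponent_pos p
  -- The limit at `π/2` needs a positive exponent and `q` may not be positive; by monotonicity in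
  -- `q` any `r` between `max q 0` and `critExponent p` serves instead.
  obtain ⟨r, hr1, hr2⟩ := exists_between (max_lt hlt hc)
  have hr0 : 0 < r := (le_max_right _ _).trans_lt hr1
  have hqr : q ≤ r := (le_max_left _ _).trans hr1.le
  have h1 := le_of_tendsto (tendsto_cusaGap_right p hr0)
    (eventually_mem_quarter_left.mono fun x hx => (cusaGap_anti p hqr hx).trans (h x hx).le)
  have h2 := boxCox_add_critExponent p
  have h3 : 1 / (3 * critExponent p) < 1 / (3 * r) :=
    one_div_lt_one_div_of_lt (by linarith) (by linarith)
  linarith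

/-! ### Numerical location of the two thresholds. -/

theorem exp_mem_of_taylor {x : ℝ} (hx : |x| ≤ 1) :
    |Real.exp x - ∑ m ∈ Finset.range 14, x ^ m / m.factorial| ≤ |x| ^ 14 * (1 / 10 ^ 10) := by
  refine (Real.exp_bound hx (by norm_num : 0 < 14)).trans ?_
  refine mul_le_mul_of_nonneg_left ?_ (by positivity)
  norm_num [Nat.factorial]

theorem log_pi_div_two_gt : 0.451582705 < Real.log (Real.pi / 2) := by
  rw [Real.lt_log_iff_exp_lt (by positivity)]
  have h := abs_le.1 (exp_mem_of_taylor (x := 0.451582705) (by norm_num [abs_le]))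
  rw [abs_of_pos (by norm_num)] at h
  have := Real.pi_gt_d20
  norm_num [Finset.sum_range_succ, Nat.factorial] at h this ⊢
  linarith [h.2]

theorem log_pi_div_two_lt : Real.log (Real.pi / 2) < 0.451582706 := by
  rw [Real.log_lt_iff_lt_exp (by positivity)]
  have h := abs_le.1 (exp_mem_of_taylor (x := 0.451582706) (by norm_num [abs_le]))
  rw [abs_of_pos (by norm_num)] at h
  have := Real.pi_lt_d20
  norm_num [Finset.sum_range_succ, Nat.factorial] at h this ⊢
  linarith [h.1]

theorem two_div_pi_rpow (p : ℝ) : (2 / Real.pi) ^ p = Real.exp (-(p * Real.log (Real.pi / 2))) := by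
  rw [Real.rpow_def_of_pos two_div_pi_pos, ← inv_div, Real.log_inv]
  ring_nf

theorem two_div_pi_rpow_lt {p y : ℝ} (hp : 0 ≤ p) (hp1 : p ≤ 2)
    (h : ∑ m ∈ Finset.range 14, (-(p * 0.451582705)) ^ m / m.factorial + 1 / 10 ^ 10 < y) :
    (2 / Real.pi) ^ p < y := by
  have habs : |-(p * 0.451582705)| ≤ 1 := by
    rw [abs_neg, abs_of_nonneg (by positivity)]
    linarith
  have h1 := (abs_le.1 (exp_mem_of_taylor habs)).2
  have h2 := pow_le_one₀ (n := 14) (abs_nonneg _) habs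
  have h3 : Real.exp (-(p * Real.log (Real.pi / 2))) ≤ Real.exp (-(p * 0.451582705)) := by
    gcongr
    exact log_pi_div_two_gt.le
  rw [two_div_pi_rpow]
  linarith

theorem lt_two_div_pi_rpow {p y : ℝ} (hp : 0 ≤ p) (hp1 : p ≤ 2)
    (h : y < ∑ m ∈ Finset.range 14, (-(p * 0.451582706)) ^ m / m.factorial - 1 / 10 ^ 10) :
    y < (2 / Real.pi) ^ p := by
  have habs : |-(p * 0.451582706)| ≤ 1 := by
    rw [abs_neg, abs_of_nonneg (by positivity)]
    linarith
  have h1 := (abs_le.1 (exp_mem_of_taylor habs)).1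
  have h2 := pow_le_one₀ (n := 14) (abs_nonneg _) habs
  have h3 : Real.exp (-(p * 0.451582706)) ≤ Real.exp (-(p * Real.log (Real.pi / 2))) := by
    gcongr
    exact log_pi_div_two_lt.le
  rw [two_div_pi_rpow]
  linarith

/-- For `p > 0`, `critExponent p = r` means `(2/π)^p = 1 - p/(3r)`; the intermediate value theorem
applies to the difference. -/
theorem exists_critExponent_eq {a b r : ℝ} (ha : 0 < a) (hab : a ≤ b) (hr : 0 < r)
    (h1 : (2 / Real.pi) ^ a < 1 - a / (3 * r)) (h2 : 1 - b / (3 * r) < (2 / Real.pi) ^ b) :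
    ∃ p ∈ Ioo a b, critExponent p = r := by
  have hcont : ContinuousOn (fun p : ℝ => (2 / Real.pi) ^ p - (1 - p / (3 * r))) (Icc a b) :=
    ((Real.continuous_const_rpow two_div_pi_pos.ne').sub (by fun_prop)).continuousOn
  obtain ⟨p, hp, h⟩ := intermediate_value_Ioo hab hcont
    (show (0 : ℝ) ∈ Ioo _ _ from ⟨by linarith, by linarith⟩)
  refine ⟨p, hp, ?_⟩
  have hp0 : 0 < p := ha.trans hp.1
  simp only at h
  rw [critExponent, if_neg hp0.ne',
    show 1 - (2 / Real.pi) ^ p = p / (3 * r) by linarith]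
  field_simp

theorem exists_critExponent_eq_one : ∃ p ∈ Ioo (1.42033 : ℝ) 1.42035, critExponent p = 1 := by
  refine exists_critExponent_eq (by norm_num) (by norm_num) one_pos
    (two_div_pi_rpow_lt (by norm_num) (by norm_num) ?_)
    (lt_two_div_pi_rpow (by norm_num) (by norm_num) ?_) <;>
  norm_num [Finset.sum_range_succ, Nat.factorial]

theorem exists_critExponent_eq_thirtyfour_div_thirtyfive :
    ∃ p ∈ Ioo (1.27753 : ℝ) 1.27755, critExponent p = 34 / 35 := by
  refine exists_critExponent_eq (by norm_num) (by norm_num) (by norm_num)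
    (two_div_pi_rpow_lt (by norm_num) (by norm_num) ?_)
    (lt_two_div_pi_rpow (by norm_num) (by norm_num) ?_) <;>
  norm_num [Finset.sum_range_succ, Nat.factorial]

/-! ### Assembly. -/

theorem mainTheorem1 :
    ∃ p₀ p₁ : ℝ,
      -- `p₀` and `p₁` are the unique solutions of `q(p) = 1` and of `q(p) = 34/35`
      (∀ p : ℝ, critExponent p = 1 ↔ p = p₀) ∧
      (∀ p : ℝ, critExponent p = 34 / 35 ↔ p = p₁) ∧
      |p₀ - 1.42034| < 0.00001 ∧
      |p₁ - 1.27754| < 0.00001 ∧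
      ∀ p q : ℝ, (p, q) ∈ admissibleRegion →
        (7 / 5 ≤ p →
          ((∀ x ∈ Ioo (0 : ℝ) (Real.pi / 2), Real.sin x / x < cusaBound (Real.cos x) p q) ↔
            p / 3 + 8 / 15 ≤ q)) ∧
        (p₀ ≤ p →
          ((∀ x ∈ Ioo (0 : ℝ) (Real.pi / 2), cusaBound (Real.cos x) p q < Real.sin x / x) ↔
            q ≤ critExponent p)) ∧
        (p ≤ 46 / 35 →
          ((∀ x ∈ Ioo (0 : ℝ) (Real.pi / 2), cusaBound (Real.cos x) p q < Real.sin x / x) ↔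
            q ≤ p / 3 + 8 / 15)) ∧
        (p ≤ p₁ →
          ((∀ x ∈ Ioo (0 : ℝ) (Real.pi / 2), Real.sin x / x < cusaBound (Real.cos x) p q) ↔
            critExponent p ≤ q)) := by
  obtain ⟨p₀, hp₀, h₀⟩ := exists_critExponent_eq_one
  obtain ⟨p₁, hp₁, h₁⟩ := exists_critExponent_eq_thirtyfour_div_thirtyfive
  refine ⟨p₀, p₁, fun p => ?_, fun p => ?_, ?_, ?_, fun p q hpq => ⟨fun hp => ?_, fun hp => ?_,
    fun hp => ?_, fun hp => ?_⟩⟩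
  · rw [← h₀]
    exact critExponent_strictMono.injective.eq_iff
  · rw [← h₁]
    exact critExponent_strictMono.injective.eq_iff
  · rw [abs_lt]
    constructor <;> linarith [hp₀.1, hp₀.2]
  · rw [abs_lt]
    constructor <;> linarith [hp₁.1, hp₁.2]
  · refine (forall_lt_cusaBound_iff hpq).trans
      ⟨taylorExponent_le_of_cusaGap_neg, fun hq x hx => ?_⟩
    -- At `p = 7/5` the value `p/3 + 8/15` is exactly 1.
    exact (cusaGap_anti p hq hx).trans_lt
      (cusaGap_neg_of_eq_taylorExponent rfl (by linarith) x hx)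
  · refine (forall_cusaBound_lt_iff hpq).trans
      ⟨le_critExponent_of_cusaGap_pos, fun hq x hx => ?_⟩
    have h := critExponent_strictMono.monotone hp
    exact (cusaGap_pos_of_eq_critExponent (h₀ ▸ h) x hx).trans_le (cusaGap_anti p hq hx)
  · refine (forall_cusaBound_lt_iff hpq).trans
      ⟨le_taylorExponent_of_cusaGap_pos, fun hq x hx => ?_⟩
    -- At `p = 46/35` the value `p/3 + 8/15` is exactly `34/35`.
    exact (cusaGap_pos_of_eq_taylorExponent rfl (by linarith) x hx).trans_le
      (cusaGap_anti p hq hx)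
  · refine (forall_lt_cusaBound_iff hpq).trans
      ⟨critExponent_le_of_cusaGap_neg, fun hq x hx => ?_⟩
    have h := critExponent_strictMono.monotone hp
    exact (cusaGap_anti p hq hx).trans_lt (cusaGap_neg_of_eq_critExponent (h₁ ▸ h) x hx)
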